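/- Let $N,M$ be positive integers and consider an undirected weighted multiplex network with $N$ nodes and $M$ layers: symmetric intralayer weights $w^{[\alpha]}_{ij}=w^{[\alpha]}_{ji}\ge 0$, intralayer diffusion constants $D^{[\alpha]}\ge 0$ and symmetric interlayer diffusion constants $D^{[\alpha,\beta]}=D^{[\beta,\alpha]}\ge 0$ ($\alpha\ne\beta$). Its supra-Laplacian $\mathcal L\in\mathbb R^{NM\times NM}$ acts on vectors $y=(y_i^{[\alpha]})$ by $$(\mathcal L y)_i^{[\alpha]}=D^{[\alpha]}\sum_{j=1}^N w^{[\alpha]}_{ij}\bigl(y_i^{[\alpha]}-y_j^{[\alpha]}\bigr)+\sum_{\beta\neq\alpha}D^{[\alpha,\beta]}\bigl(y_i^{[\alpha]}-y_i^{[\beta]}\bigr).$$ Assume that the network is connected, i.e. any replica node $(i,\alpha)$ can be reached from any other one along intralinks $(i,\alpha)\sim(j,\alpha)$ with $D^{[\alpha]}w^{[\alpha]}_{ij}>0$ and interlinks $(i,\alpha)\sim(i,\beta)$ with $D^{[\alpha,\beta]}>0$. Let $\tilde f:\mathbb R^{NM}\to\mathbb R$ be convex and twice continuously differentiable, and assume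 that the original problem $$\min_{x\in\mathbb R} f(x),\qquad f(x)=\tilde f(x\mathbf 1),$$ has a minimizer (for $\tilde f(y)=\sum_{\alpha}\sum_i f_i^{[\alpha]}(y_i^{[\alpha]})$ one has $f(x)=\sum_{\alpha}\sum_i f_i^{[\alpha]}(x)$). Let $$\mathcal L_a(y,\lambda)=\tilde f(y)+\lambda^{\top}\mathcal L y+\tfrac12 y^{\top}\mathcal L y.$$ Then every trajectory $(y(t),\lambda(t))$, $t\ge 0$, of the saddle-point flow $$\dot y=-\nabla\tilde f(y)-\mathcal L y-\mathcal L\lambda,\qquad \dot\lambda=\mathcal L y$$ converges as $t\to\infty$ to a single point $(y^\star,\lambda^\star)$, which is a saddle point of $\mathcal L_a$, that is, $\mathcal L_a(y^\star,\lambda)\le\mathcal L_a(y^\star,\lambda^\star)\le\mathcal L_a(y,\lambda^\star)$ for all $y,\lambda\in\mathbb R^{NM}$. Moreover: 1. $y^\star=x^\star\mathbf 1$, where $x^\star\in\mathbb R$ is a minimizer of the original problem; 2. $\lambda^\star=\bar\lambda+\operatorname{average}(\lambda(0))\,\mathbf 1$, where $\operatorname{average}(\lambda(0))$ is the mean of the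 $NM$ entries of $\lambda(0)$, and $\bar\lambda\perp\mathbf 1$ satisfies $\mathcal L\bar\lambda+\nabla\tilde f(y^\star)=0$. -/

import Mathlib

open Set Filter Topology

/-- An undirected weighted multiplex network with `N` nodes and `M` layers. The replica node of
node `i` in layer `α` is the pair `(i, α)`. -/
structure MultiplexNetwork (N M : ℕ) where
  /-- `w α i j` is the weight of the intralink between `(i, α)` and `(j, α)` (`0`: no link). -/
  w : Fin M → Fin N → Fin N → ℝ
  w_symm : ∀ α i j, w α i j = w α j i
  w_nonneg : ∀ α i j, 0 ≤ w α i j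
  /-- The intralayer diffusion constants. -/
  D : Fin M → ℝ
  D_nonneg : ∀ α, 0 ≤ D α
  /-- The interlayer diffusion constants (the diagonal values play no role). -/
  Dinter : Fin M → Fin M → ℝ
  Dinter_symm : ∀ α β, Dinter α β = Dinter β α
  Dinter_nonneg : ∀ α β, 0 ≤ Dinter α β

/-- The space of vectors `y = (y_i^[α])` indexed by the replica nodes, with the Euclidean norm. -/
abbrev ReplicaSpace (N M : ℕ) : Type := EuclideanSpace ℝ (Fin N × Fin M)

/-- The all-ones vector. -/
noncomputable def onesVec (N M : ℕ) : ReplicaSpace N M := WithLp.toLp 2 (fun _ => 1)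

/-- The average of the entries of a vector. -/
noncomputable def replicaAverage {N M : ℕ} (v : ReplicaSpace N M) : ℝ :=
  (∑ p, v p) / ((N : ℝ) * (M : ℝ))

namespace MultiplexNetwork

variable {N M : ℕ} (G : MultiplexNetwork N M)

/-- The graph on the replica nodes whose edges are the intralinks and interlinks along which
diffusion takes place, that is, those with positive diffusion coefficient. -/
def replicaGraph : SimpleGraph (Fin N × Fin M) where
  Adj p q := p ≠ q ∧
    ((p.2 = q.2 ∧ 0 < G.D p.2 * G.w p.2 p.1 q.1) ∨ (p.1 = q.1 ∧ 0 < G.Dinter p.2 q.2))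
  symm := ⟨by
    rintro ⟨i, α⟩ ⟨j, β⟩ ⟨hne, h⟩
    refine ⟨hne.symm, ?_⟩
    rcases h with ⟨h1, h2⟩ | ⟨h1, h2⟩
    · left
      dsimp only at h1 h2 ⊢
      subst h1
      exact ⟨rfl, by rw [G.w_symm]; exact h2⟩
    · right
      exact ⟨h1.symm, by rw [G.Dinter_symm]; exact h2⟩⟩
  loopless := ⟨fun _ h => h.1 rfl⟩

/-- Any replica node can be reached from any other one through intralinks and interlinks
(and there is at least one replica node). -/
def Connected : Prop := G.replicaGraph.Connected

/-- The Laplacian of layer `α`, with entries `s_i δ_ij - w_ij` where `s_i = ∑ j, w_ij`. -/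
def layerLaplacian (α : Fin M) : Matrix (Fin N) (Fin N) ℝ :=
  Matrix.diagonal (fun i => ∑ j, G.w α i j) - Matrix.of (G.w α)

/-- The block diagonal intralayer part, with blocks `D^[α] L^[α]`. -/
def intraPart : Matrix (Fin N × Fin M) (Fin N × Fin M) ℝ :=
  Matrix.blockDiagonal (fun α => G.D α • G.layerLaplacian α)

/-- The interlayer part: the block `(α, α)` is `(∑ β ≠ α, D^[α,β]) I` and, for `α ≠ β`, the block
`(α, β)` is `- D^[α,β] I`. -/
def interPart : Matrix (Fin N × Fin M) (Fin N × Fin M) ℝ :=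
  Matrix.of fun p q =>
    if p.1 = q.1 then
      if p.2 = q.2 then ∑ β ∈ Finset.univ.erase p.2, G.Dinter p.2 β else - G.Dinter p.2 q.2
    else 0

/-- The supra-Laplacian matrix. -/
def supraLaplacian : Matrix (Fin N × Fin M) (Fin N × Fin M) ℝ :=
  G.intraPart + G.interPart

/-- The supra-Laplacian as a linear operator on the space of replica vectors. -/
noncomputable def supraLap : ReplicaSpace N M →ₗ[ℝ] ReplicaSpace N M :=
  Matrix.toEuclideanLin G.supraLaplacian

/-- The augmented supra-Lagrangian `f(y) + lᵀ 𝓛 y + (1/2) yᵀ 𝓛 y`. -/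
noncomputable def augLagrangian (f : ReplicaSpace N M → ℝ) (y l : ReplicaSpace N M) : ℝ :=
  f y + inner ℝ l (G.supraLap y) + (1 / 2) * inner ℝ y (G.supraLap y)

/-- `(y, l)` is a trajectory, on `[0, ∞)`, of the saddle-point dynamics
`y' = -∇f(y) - 𝓛 y - 𝓛 l`, `l' = 𝓛 y`. -/
structure IsTrajectory (f : ReplicaSpace N M → ℝ) (y l : ℝ → ReplicaSpace N M) : Prop where
  primal : ∀ t, 0 ≤ t → HasDerivWithinAt y
    (-gradient f (y t) - G.supraLap (y t) - G.supraLap (l t)) (Ici 0) t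
  dual : ∀ t, 0 ≤ t → HasDerivWithinAt l (G.supraLap (y t)) (Ici 0) t

end MultiplexNetwork

/-- The objective `x ↦ f(x, …, x)` of the original problem over one scalar decision variable. -/
noncomputable def primalObjective {N M : ℕ} (f : ReplicaSpace N M → ℝ) (x : ℝ) : ℝ :=
  f (x • onesVec N M)

/-- For a sum of individual costs, the objective of the original problem is `∑_α ∑_i f_i^[α](x)`. -/
theorem primalObjective_sum {N M : ℕ} (c : Fin M → Fin N → ℝ → ℝ) (x : ℝ) :
    primalObjective (fun y : ReplicaSpace N M => ∑ α, ∑ i, c α i (y (i, α))) x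
      = ∑ α, ∑ i, c α i x := by
  simp [primalObjective, onesVec]

/-! Write `A` for the supra-Laplacian: symmetric, positive semidefinite and, by connectedness, with
kernel spanned by the all-ones vector. Equilibria are the pairs `(a, b)` with `A a = 0` and `A b +
∇f(a) = 0`. One exists: at a minimizer `x` the gradient of `f` at `x • 1` is orthogonal to `1`,
hence lies in the range of `A`. The squared distance from the trajectory to any equilibrium is
antitone, since the primal-dual coupling is skew and cancels, leaving the dissipation `⟪y - a, ∇f(y)
- ∇f(a)⟫ + ⟪y, A y⟫ ≥ 0` (`saddleFlow_hasDerivWithinAt_dist_sq`). Barbalat's lemma makes the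
dissipation vanish, so `A y → 0`; applied again to `A y`, it gives `A y' → 0`. These limits force
every limit point to be an equilibrium (`saddleFlow_exists_limitPoint`). The distance to this new
equilibrium is antitone and tends to zero along a subsequence, hence tends to zero. Convexity turns
the equilibrium equations into the saddle and minimality claims; conservation of the mean of the
multiplier fixes its component along `1`. -/

/-! ### Gradients of convex functions -/

section ConvexGradient

variable {E : Type*} [NormedAddCommGroup E] [InnerProductSpace ℝ E] [CompleteSpace E]

/-- First-order characterization of convexity. -/
theorem ConvexOn.add_inner_gradient_le {f : E → ℝ} (hconv : ConvexOn ℝ univ f) {x : E}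
    (hf : DifferentiableAt ℝ f x) (z : E) :
    f x + inner ℝ (gradient f x) (z - x) ≤ f z := by
  have hg : ConvexOn ℝ univ (f ∘ AffineMap.lineMap (k := ℝ) x z) := by
    simpa using hconv.comp_affineMap (AffineMap.lineMap (k := ℝ) x z)
  have h1 : HasDerivAt (f ∘ AffineMap.lineMap (k := ℝ) x z) (inner ℝ (gradient f x) (z - x)) 0 := by
    have h2 : HasFDerivAt f (fderiv ℝ f x) (AffineMap.lineMap (k := ℝ) x z 0) := by
      simpa using hf.hasFDerivAt
    have h3 := h2.comp_hasDerivAt (0 : ℝ) (AffineMap.hasDerivAt_lineMap (a := x) (b := z))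
    simpa [gradient] using h3
  have h4 := hg.le_slope_of_hasDerivAt (mem_univ 0) (mem_univ 1) one_pos h1
  have h5 : inner ℝ (gradient f x) (z - x) ≤ f z - f x := by
    simpa [slope, -map_sub] using h4
  linarith

/-- The gradient of a convex function is a monotone operator. -/
theorem ConvexOn.inner_sub_gradient_sub_nonneg {f : E → ℝ} (hconv : ConvexOn ℝ univ f)
    (hf : Differentiable ℝ f) (x z : E) :
    0 ≤ inner ℝ (x - z) (gradient f x - gradient f z) := by
  have h1 := hconv.add_inner_gradient_le (hf x) z
  have h2 := hconv.add_inner_gradient_le (hf z) x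
  rw [← neg_sub x z, inner_neg_right] at h1
  rw [real_inner_comm, inner_sub_left]
  linarith

theorem ConvexOn.gradient_eq_of_inner_eq_zero {f : E → ℝ} (hconv : ConvexOn ℝ univ f)
    (hf : Differentiable ℝ f) {x z : E}
    (h : inner ℝ (x - z) (gradient f x - gradient f z) = 0) :
    gradient f x = gradient f z := by
  have h1 := hconv.add_inner_gradient_le (hf x) z
  rw [real_inner_comm, inner_sub_left] at h
  rw [← neg_sub x z, inner_neg_right] at h1
  -- Zero pairing makes the first-order bounds at `x` and `z` tight, so the tilted function, minimal
  -- at `z`, is also minimal at `x`.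
  have hloc : IsLocalMin (fun u => f u - inner ℝ (gradient f z) u) x := by
    refine Filter.Eventually.of_forall fun u => ?_
    have h2 := hconv.add_inner_gradient_le (hf z) u
    simp only [inner_sub_right] at *
    linarith
  have hd : HasFDerivAt (fun u => f u - inner ℝ (gradient f z) u)
      (fderiv ℝ f x - innerSL ℝ (gradient f z)) x :=
    (hf x).hasFDerivAt.sub (innerSL ℝ (gradient f z)).hasFDerivAt
  have h0 := hloc.hasFDerivAt_eq_zero hd
  refine ext_inner_right ℝ fun v => ?_
  have h3 := DFunLike.congr_fun h0 v
  simp only [_root_.sub_apply, innerSL_apply_apply,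
    _root_.zero_apply] at h3
  rw [show inner ℝ (gradient f x) v = fderiv ℝ f x v by simp [gradient]]
  linarith

theorem ContDiff.continuous_gradient {f : E → ℝ} (hf : ContDiff ℝ 1 f) :
    Continuous (gradient f) :=
  (InnerProductSpace.toDual ℝ E).symm.continuous.comp (hf.continuous_fderiv (by norm_num))

end ConvexGradient

/-! ### Barbalat's lemma -/

section Barbalat

/-- Barbalat's lemma. -/
theorem tendsto_deriv_zero_of_uniformContinuousOn {F : Type*} [NormedAddCommGroup F]
    [NormedSpace ℝ F] {g g' : ℝ → F} {c : F}
    (hg : ∀ t, 0 ≤ t → HasDerivWithinAt g (g' t) (Ici 0) t)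
    (hlim : Tendsto g atTop (𝓝 c)) (huc : UniformContinuousOn g' (Ici 0)) :
    Tendsto g' atTop (𝓝 0) := by
  rw [Metric.tendsto_atTop]
  intro ε hε
  obtain ⟨δ, hδ, hu⟩ := Metric.uniformContinuousOn_iff.1 huc (ε / 2) (half_pos hε)
  set h := δ / 2 with hh
  have hpos : 0 < h := by positivity
  have hdiff : Tendsto (fun t => g (t + h) - g t) atTop (𝓝 0) := by
    simpa using (hlim.comp (tendsto_atTop_add_const_right _ h tendsto_id)).sub hlim
  obtain ⟨T, hT⟩ := Metric.tendsto_atTop.1 hdiff (ε / 2 * h) (by positivity)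
  refine ⟨max T 0, fun t ht => ?_⟩
  have ht0 : 0 ≤ t := (le_max_right _ _).trans ht
  have hT' := hT t ((le_max_left _ _).trans ht)
  -- With the slope at `t` subtracted, the derivative is at most `ε / 2` on a window shorter than
  -- `δ`, so `h • g' t` is within `ε / 2 * h` of an increment that tends to zero.
  have hmv := (convex_Icc t (t + h)).norm_image_sub_le_of_norm_hasDerivWithin_le
    (f := fun s => g s - s • g' t) (f' := fun s => g' s - g' t) (C := ε / 2) (x := t) (y := t + h)
    (fun s hs => by
      have h1 := (hg s (ht0.trans hs.1)).mono
        (show Icc t (t + h) ⊆ Ici 0 from fun u hu => ht0.trans hu.1)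
      have h2 := h1.sub ((hasDerivWithinAt_id s _).smul_const (g' t))
      rw [one_smul] at h2
      exact h2)
    (fun s hs => by
      rw [← dist_eq_norm]
      refine (hu s (ht0.trans hs.1) t ht0 ?_).le
      rw [Real.dist_eq, abs_of_nonneg (by linarith [hs.1])]
      linarith [hs.2])
    (left_mem_Icc.2 (by linarith)) (right_mem_Icc.2 (by linarith))
  have e : h • g' t = (g (t + h) - g t) -
      ((g (t + h) - (t + h) • g' t) - (g t - t • g' t)) := by
    rw [add_smul]; abel
  have hn : h * ‖g' t‖ < h * ε := by
    calc h * ‖g' t‖ = ‖h • g' t‖ := by rw [norm_smul, Real.norm_of_nonneg hpos.le]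
      _ ≤ ‖g (t + h) - g t‖ + ‖(g (t + h) - (t + h) • g' t) - (g t - t • g' t)‖ := by
        rw [e]; exact norm_sub_le _ _
      _ < ε / 2 * h + ε / 2 * h := by
        refine add_lt_add_of_lt_of_le (by simpa using hT') (hmv.trans_eq ?_)
        simp [abs_of_pos hpos]
      _ = h * ε := by ring
  simpa using lt_of_mul_lt_mul_left hn hpos.le

theorem IsCompact.uniformContinuousOn_comp {X Y : Type*} [UniformSpace X]
    [UniformSpace Y] {K : Set X} (hK : IsCompact K) {Φ : X → Y} (hΦ : Continuous Φ)
    {z : ℝ → X} {s : Set ℝ} (hz : UniformContinuousOn z s) (hzK : MapsTo z s K) :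
    UniformContinuousOn (fun t => Φ (z t)) s :=
  (hK.uniformContinuousOn_of_continuous hΦ.continuousOn).comp hz hzK

end Barbalat

/-! ### Convergence of the abstract saddle-point flow -/

section SaddleFlow

variable {E : Type*} [NormedAddCommGroup E] [InnerProductSpace ℝ E]

theorem ContinuousLinearMap.norm_sq_apply_le_of_inner_nonneg {A : E →L[ℝ] E}
    (hsymm : ∀ u v, inner ℝ (A u) v = inner ℝ u (A v)) (hpos : ∀ v, 0 ≤ inner ℝ v (A v)) (v : E) :
    ‖A v‖ ^ 2 ≤ (‖A‖ + 1) * inner ℝ v (A v) := by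
  have hC : 0 < ‖A‖ + 1 := by positivity
  -- Positivity at this vector, expanded with `C = ‖A‖ + 1`, gives `C‖A v‖² ≤ C²⟪v, A v⟫`; the `+ 1`
  -- lets `C` be cancelled even when `A = 0`.
  have h1 := hpos ((‖A‖ + 1) • v - A v)
  have h2 : inner ℝ (A v) (A (A v)) ≤ (‖A‖ + 1) * ‖A v‖ ^ 2 := by
    have h3 := real_inner_le_norm (A v) (A (A v))
    have h4 := mul_le_mul_of_nonneg_left (A.le_opNorm (A v)) (norm_nonneg (A v))
    nlinarith [sq_nonneg ‖A v‖]
  simp only [map_sub, map_smul, inner_sub_left, inner_sub_right, real_inner_smul_left,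
    real_inner_smul_right, ← hsymm v (A v), real_inner_self_eq_norm_sq] at h1
  refine le_of_mul_le_mul_left ?_ hC
  nlinarith

variable [CompleteSpace E] {A : E →L[ℝ] E} {f : E → ℝ} {y l : ℝ → E}

theorem saddleFlow_hasDerivWithinAt_dist_sq
    (hsymm : ∀ u v, inner ℝ (A u) v = inner ℝ u (A v))
    (hy : ∀ t, 0 ≤ t → HasDerivWithinAt y (-gradient f (y t) - A (y t) - A (l t)) (Ici 0) t)
    (hl : ∀ t, 0 ≤ t → HasDerivWithinAt l (A (y t)) (Ici 0) t)
    {a b : E} (ha : A a = 0) (hab : A b + gradient f a = 0) {t : ℝ} (ht : 0 ≤ t) :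
    HasDerivWithinAt (fun t => ‖y t - a‖ ^ 2 + ‖l t - b‖ ^ 2)
      (-2 * (inner ℝ (y t - a) (gradient f (y t) - gradient f a) + inner ℝ (y t) (A (y t))))
      (Ici 0) t := by
  refine (((hy t ht).sub_const a).norm_sq.add
    ((hl t ht).sub_const b).norm_sq).congr_deriv ?_
  have h1 : inner ℝ (l t - b) (A (y t)) = inner ℝ (y t - a) (A (l t) - A b) := by
    rw [← map_sub, ← hsymm (y t - a), map_sub, ha, sub_zero, real_inner_comm]
  have h2 : inner ℝ (y t - a) (A (y t)) = inner ℝ (y t) (A (y t)) := by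
    rw [inner_sub_left, ← hsymm a, ha, inner_zero_left, sub_zero]
  rw [h1, eq_neg_of_add_eq_zero_right hab, ← h2]
  simp only [inner_sub_right, inner_neg_right]
  ring

theorem saddleFlow_antitoneOn_dist_sq (hf : Differentiable ℝ f) (hconv : ConvexOn ℝ univ f)
    (hsymm : ∀ u v, inner ℝ (A u) v = inner ℝ u (A v)) (hpos : ∀ v, 0 ≤ inner ℝ v (A v))
    (hy : ∀ t, 0 ≤ t → HasDerivWithinAt y (-gradient f (y t) - A (y t) - A (l t)) (Ici 0) t)
    (hl : ∀ t, 0 ≤ t → HasDerivWithinAt l (A (y t)) (Ici 0) t)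
    {a b : E} (ha : A a = 0) (hab : A b + gradient f a = 0) :
    AntitoneOn (fun t => ‖y t - a‖ ^ 2 + ‖l t - b‖ ^ 2) (Ici 0) := by
  have hd := fun t (ht : 0 ≤ t) => saddleFlow_hasDerivWithinAt_dist_sq hsymm hy hl ha hab ht
  refine antitoneOn_of_hasDerivWithinAt_nonpos (convex_Ici 0)
    (fun t ht => (hd t ht).continuousWithinAt)
    (fun t ht => (hd t (interior_subset ht)).mono interior_subset) fun t _ => ?_
  have := hconv.inner_sub_gradient_sub_nonneg hf (y t) a
  linarith [hpos (y t)]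

/-- An antitone function on `[0, ∞)` that is bounded below converges. -/
theorem AntitoneOn.exists_tendsto_atTop {g : ℝ → ℝ} (hg : AntitoneOn g (Ici 0))
    (h0 : ∀ t, 0 ≤ g t) : ∃ c, Tendsto g atTop (𝓝 c) := by
  have hanti : Antitone fun t => g (max t 0) := fun s t hst =>
    hg (mem_Ici.2 (le_max_right _ _)) (mem_Ici.2 (le_max_right _ _)) (max_le_max_right 0 hst)
  refine ⟨_, (tendsto_atTop_ciInf hanti ⟨0, ?_⟩).congr' ?_⟩
  · rintro _ ⟨t, rfl⟩
    exact h0 _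
  · filter_upwards [eventually_ge_atTop 0] with t ht
    rw [max_eq_left ht]

/-- A trajectory of the saddle-point flow is bounded and uniformly continuous if there is an
equilibrium. -/
theorem saddleFlow_exists_isCompact [FiniteDimensional ℝ E]
    (hf : ContDiff ℝ 1 f) (hconv : ConvexOn ℝ univ f)
    (hsymm : ∀ u v, inner ℝ (A u) v = inner ℝ u (A v)) (hpos : ∀ v, 0 ≤ inner ℝ v (A v))
    (hy : ∀ t, 0 ≤ t → HasDerivWithinAt y (-gradient f (y t) - A (y t) - A (l t)) (Ici 0) t)
    (hl : ∀ t, 0 ≤ t → HasDerivWithinAt l (A (y t)) (Ici 0) t)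
    {a b : E} (ha : A a = 0) (hab : A b + gradient f a = 0) :
    ∃ K : Set (E × E), IsCompact K ∧ MapsTo (fun t => (y t, l t)) (Ici 0) K ∧
      UniformContinuousOn (fun t => (y t, l t)) (Ici 0) := by
  have hfd : Differentiable ℝ f := hf.differentiable (by norm_num)
  have hgc : Continuous (gradient f) := hf.continuous_gradient
  have hproper : ProperSpace E := FiniteDimensional.proper ℝ E
  have hanti := saddleFlow_antitoneOn_dist_sq hfd hconv hsymm hpos hy hl ha hab
  set R := ‖y 0 - a‖ ^ 2 + ‖l 0 - b‖ ^ 2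
  -- Radius `R + 1` avoids a square root: `r² ≤ R` implies `r ≤ R + 1`.
  set K : Set (E × E) := Metric.closedBall a (R + 1) ×ˢ Metric.closedBall b (R + 1)
  have hK : IsCompact K := (isCompact_closedBall _ _).prod (isCompact_closedBall _ _)
  have hzK : MapsTo (fun t => (y t, l t)) (Ici 0) K := by
    intro t ht
    have h1 : ‖y t - a‖ ^ 2 + ‖l t - b‖ ^ 2 ≤ R := hanti self_mem_Ici ht ht
    constructor <;> rw [mem_closedBall_iff_norm] <;> dsimp only <;>
      nlinarith [sq_nonneg (‖y t - a‖ - 1), sq_nonneg (‖l t - b‖ - 1),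
        sq_nonneg ‖y t - a‖, sq_nonneg ‖l t - b‖]
  have hF : Continuous fun z : E × E => -gradient f z.1 - A z.1 - A z.2 := by fun_prop
  have hz : UniformContinuousOn (fun t => (y t, l t)) (Ici 0) := by
    obtain ⟨C, hC⟩ := hK.exists_bound_of_continuousOn
      (f := fun z : E × E => ((-gradient f z.1 - A z.1 - A z.2, A z.1) : E × E))
      (by fun_prop)
    refine (Convex.lipschitzOnWith_of_nnnorm_hasDerivWithin_le (C := C.toNNReal) (convex_Ici 0)
      (fun t ht => (hy t ht).prodMk (hl t ht)) fun t ht => ?_).uniformContinuousOn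
    exact NNReal.le_toNNReal_of_coe_le (hC _ (hzK ht))
  exact ⟨K, hK, hzK, hz⟩

/-- The dissipation of the saddle-point flow tends to zero. -/
theorem saddleFlow_tendsto_dissipation [FiniteDimensional ℝ E]
    (hf : ContDiff ℝ 1 f) (hconv : ConvexOn ℝ univ f)
    (hsymm : ∀ u v, inner ℝ (A u) v = inner ℝ u (A v)) (hpos : ∀ v, 0 ≤ inner ℝ v (A v))
    (hy : ∀ t, 0 ≤ t → HasDerivWithinAt y (-gradient f (y t) - A (y t) - A (l t)) (Ici 0) t)
    (hl : ∀ t, 0 ≤ t → HasDerivWithinAt l (A (y t)) (Ici 0) t)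
    {a b : E} (ha : A a = 0) (hab : A b + gradient f a = 0) :
    Tendsto (fun t => inner ℝ (y t - a) (gradient f (y t) - gradient f a)) atTop (𝓝 0) ∧
      Tendsto (fun t => A (y t)) atTop (𝓝 0) ∧
      Tendsto (fun t => A (-gradient f (y t) - A (y t) - A (l t))) atTop (𝓝 0) := by
  have hfd : Differentiable ℝ f := hf.differentiable (by norm_num)
  have hgc : Continuous (gradient f) := hf.continuous_gradient
  obtain ⟨K, hK, hzK, hz⟩ := saddleFlow_exists_isCompact hf hconv hsymm hpos hy hl ha hab
  have hanti := saddleFlow_antitoneOn_dist_sq hfd hconv hsymm hpos hy hl ha hab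
  have hF : Continuous fun z : E × E => -gradient f z.1 - A z.1 - A z.2 := by fun_prop
  obtain ⟨c, hc⟩ := hanti.exists_tendsto_atTop fun t => by positivity
  have huc : UniformContinuousOn (fun t => -2 * (inner ℝ (y t - a)
      (gradient f (y t) - gradient f a) + inner ℝ (y t) (A (y t)))) (Ici 0) :=
    hK.uniformContinuousOn_comp (z := fun t => (y t, l t)) (Φ := fun z : E × E => -2 * (inner ℝ (z.1 - a)
      (gradient f z.1 - gradient f a) + inner ℝ z.1 (A z.1))) (by fun_prop) hz hzK
  have hq := tendsto_deriv_zero_of_uniformContinuousOn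
    (fun t ht => saddleFlow_hasDerivWithinAt_dist_sq hsymm hy hl ha hab ht) hc huc
  have hq' : Tendsto (fun t => inner ℝ (y t - a) (gradient f (y t) - gradient f a) +
      inner ℝ (y t) (A (y t))) atTop (𝓝 0) := by
    have h1 := hq.const_mul (-1 / 2 : ℝ)
    rw [mul_zero] at h1
    exact h1.congr fun t => by ring
  have hq1 : Tendsto (fun t => inner ℝ (y t - a) (gradient f (y t) - gradient f a))
      atTop (𝓝 0) :=
    squeeze_zero (fun t => hconv.inner_sub_gradient_sub_nonneg hfd _ _)
      (fun t => le_add_of_nonneg_right (hpos _)) hq'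
  have hq2 : Tendsto (fun t => inner ℝ (y t) (A (y t))) atTop (𝓝 0) :=
    squeeze_zero (fun t => hpos _)
      (fun t => le_add_of_nonneg_left (hconv.inner_sub_gradient_sub_nonneg hfd _ _)) hq'
  have hAy : Tendsto (fun t => A (y t)) atTop (𝓝 0) := by
    have h1 : Tendsto (fun t => ‖A (y t)‖ ^ 2) atTop (𝓝 0) :=
      squeeze_zero (fun t => by positivity)
        (fun t => A.norm_sq_apply_le_of_inner_nonneg hsymm hpos (y t))
        (by simpa using hq2.const_mul (‖A‖ + 1))
    have h2 := h1.sqrt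
    simp only [Real.sqrt_sq (norm_nonneg _), Real.sqrt_zero] at h2
    exact tendsto_zero_iff_norm_tendsto_zero.2 h2
  have hdA : ∀ t, 0 ≤ t → HasDerivWithinAt (fun t => A (y t))
      (A (-gradient f (y t) - A (y t) - A (l t))) (Ici 0) t :=
    fun t ht => A.hasFDerivAt.comp_hasDerivWithinAt t (hy t ht)
  -- Second use of Barbalat: this controls the multiplier, which the dissipation does not see.
  have hucA : UniformContinuousOn (fun t => A (-gradient f (y t) - A (y t) - A (l t))) (Ici 0) :=
    hK.uniformContinuousOn_comp (z := fun t => (y t, l t)) (A.continuous.comp hF) hz hzK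
  have hAy' := tendsto_deriv_zero_of_uniformContinuousOn hdA hAy hucA
  exact ⟨hq1, hAy, hAy'⟩

/-- A trajectory of the saddle-point flow has an equilibrium among its limit points if there is
an equilibrium. -/
theorem saddleFlow_exists_limitPoint [FiniteDimensional ℝ E]
    (hf : ContDiff ℝ 1 f) (hconv : ConvexOn ℝ univ f)
    (hsymm : ∀ u v, inner ℝ (A u) v = inner ℝ u (A v)) (hpos : ∀ v, 0 ≤ inner ℝ v (A v))
    (hy : ∀ t, 0 ≤ t → HasDerivWithinAt y (-gradient f (y t) - A (y t) - A (l t)) (Ici 0) t)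
    (hl : ∀ t, 0 ≤ t → HasDerivWithinAt l (A (y t)) (Ici 0) t)
    {a b : E} (ha : A a = 0) (hab : A b + gradient f a = 0) :
    ∃ a' b', A a' = 0 ∧ A b' + gradient f a' = 0 ∧ ∃ τ : ℕ → ℝ, Tendsto τ atTop atTop ∧
      Tendsto (fun n => y (τ n)) atTop (𝓝 a') ∧ Tendsto (fun n => l (τ n)) atTop (𝓝 b') := by
  have hfd : Differentiable ℝ f := hf.differentiable (by norm_num)
  have hgc : Continuous (gradient f) := hf.continuous_gradient
  obtain ⟨K, hK, hzK, -⟩ := saddleFlow_exists_isCompact hf hconv hsymm hpos hy hl ha hab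
  obtain ⟨hq1, hAy, hAy'⟩ :=
    saddleFlow_tendsto_dissipation hf hconv hsymm hpos hy hl ha hab
  have hF : Continuous fun z : E × E => -gradient f z.1 - A z.1 - A z.2 := by fun_prop
  obtain ⟨⟨a', b'⟩, -, φ, hφ, hlim⟩ := hK.tendsto_subseq (x := fun n : ℕ => (y n, l n))
    fun n => hzK (mem_Ici.2 n.cast_nonneg)
  have hτ : Tendsto (fun n => ((φ n : ℕ) : ℝ)) atTop atTop :=
    tendsto_natCast_atTop_atTop.comp hφ.tendsto_atTop
  generalize hτ_def : (fun n => ((φ n : ℕ) : ℝ)) = τ at hτ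
  replace hlim : Tendsto (fun n => (y (τ n), l (τ n))) atTop (𝓝 (a', b')) := by
    rw [← hτ_def]
    exact hlim
  have hlim1 : Tendsto (fun n => y (τ n)) atTop (𝓝 a') := (continuous_fst.tendsto _).comp hlim
  have hlim2 : Tendsto (fun n => l (τ n)) atTop (𝓝 b') := (continuous_snd.tendsto _).comp hlim
  have ha' : A a' = 0 :=
    tendsto_nhds_unique (f := fun n => A (y (τ n))) ((A.continuous.tendsto a').comp hlim1)
      (hAy.comp hτ)
  have hgrad : gradient f a' = gradient f a := by
    have hc1 : Continuous fun u => inner ℝ (u - a) (gradient f u - gradient f a) := by fun_prop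
    have h1 := (hc1.tendsto a').comp hlim1
    have h2 := hq1.comp hτ
    exact hconv.gradient_eq_of_inner_eq_zero hfd (tendsto_nhds_unique (f := fun n =>
      inner ℝ (y (τ n) - a) (gradient f (y (τ n)) - gradient f a)) h1 h2)
  have hlimF := ((A.continuous.comp hF).tendsto (a', b')).comp hlim
  have hAF : A (-gradient f a' - A a' - A b') = 0 :=
    tendsto_nhds_unique
      (f := fun n => A (-gradient f (y (τ n)) - A (y (τ n)) - A (l (τ n))))
      hlimF (hAy'.comp hτ)
  have hab' : A b' + gradient f a' = 0 := by
    -- What remains is `A (A (b - b')) = 0`; for symmetric `A` this forces `A b = A b'`.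
    rw [hgrad, ha', sub_zero, eq_neg_of_add_eq_zero_right hab, neg_neg, ← map_sub] at hAF
    have h1 : inner ℝ (A (b - b')) (A (b - b')) = (0 : ℝ) := by
      rw [hsymm, hAF, inner_zero_right]
    have h2 := inner_self_eq_zero.1 h1
    rw [map_sub, sub_eq_zero] at h2
    rw [hgrad, ← h2, hab]
  exact ⟨a', b', ha', hab', _, hτ, hlim1, hlim2⟩

/-- A trajectory of the saddle-point flow of a convex function with linear constraint operator
`A` converges to an equilibrium, provided that there is one. -/
theorem saddleFlow_tendsto [FiniteDimensional ℝ E]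
    (hf : ContDiff ℝ 1 f) (hconv : ConvexOn ℝ univ f)
    (hsymm : ∀ u v, inner ℝ (A u) v = inner ℝ u (A v)) (hpos : ∀ v, 0 ≤ inner ℝ v (A v))
    (hy : ∀ t, 0 ≤ t → HasDerivWithinAt y (-gradient f (y t) - A (y t) - A (l t)) (Ici 0) t)
    (hl : ∀ t, 0 ≤ t → HasDerivWithinAt l (A (y t)) (Ici 0) t)
    (heq : ∃ a b, A a = 0 ∧ A b + gradient f a = 0) :
    ∃ a b, A a = 0 ∧ A b + gradient f a = 0 ∧ Tendsto y atTop (𝓝 a) ∧ Tendsto l atTop (𝓝 b) := by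
  obtain ⟨a, b, ha, hab⟩ := heq
  have hfd : Differentiable ℝ f := hf.differentiable (by norm_num)
  obtain ⟨a', b', ha', hab', τ, hτ, hlim1, hlim2⟩ :=
    saddleFlow_exists_limitPoint hf hconv hsymm hpos hy hl ha hab
  -- the distance to that equilibrium is antitone and has a subsequence tending to zero
  have hanti' := saddleFlow_antitoneOn_dist_sq hfd hconv hsymm hpos hy hl ha' hab'
  obtain ⟨c', hc'⟩ := hanti'.exists_tendsto_atTop fun t => by positivity
  have hc0 : c' = 0 := by
    have h1 := ((hlim1.sub_const a').norm.pow 2).add ((hlim2.sub_const b').norm.pow 2)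
    have h2 := hc'.comp hτ
    simp only [sub_self, norm_zero, ne_eq, OfNat.ofNat_ne_zero, not_false_eq_true, zero_pow,
      add_zero] at h1
    exact tendsto_nhds_unique h2 h1
  rw [hc0] at hc'
  have tend : ∀ (u : ℝ → E) (v : E), (∀ t, ‖u t - v‖ ^ 2 ≤ ‖y t - a'‖ ^ 2 + ‖l t - b'‖ ^ 2) →
      Tendsto u atTop (𝓝 v) := by
    intro u v huv
    have h2 := (squeeze_zero (fun t => sq_nonneg ‖u t - v‖) huv hc').sqrt
    simp only [Real.sqrt_sq (norm_nonneg _), Real.sqrt_zero] at h2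
    exact tendsto_iff_norm_sub_tendsto_zero.2 h2
  exact ⟨a', b', ha', hab', tend y a' fun t => le_add_of_nonneg_right (sq_nonneg _),
    tend l b' fun t => le_add_of_nonneg_left (sq_nonneg _)⟩

end SaddleFlow

/-! ### The supra-Laplacian as a weighted graph Laplacian -/

namespace MultiplexNetwork

variable {N M : ℕ} (G : MultiplexNetwork N M)

/-- The coefficient of diffusion between two replica nodes. -/
def diffusionCoeff (p q : Fin N × Fin M) : ℝ :=
  (if p.2 = q.2 then G.D p.2 * G.w p.2 p.1 q.1 else 0) +
    if p.1 = q.1 ∧ p.2 ≠ q.2 then G.Dinter p.2 q.2 else 0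

theorem diffusionCoeff_symm (p q : Fin N × Fin M) :
    G.diffusionCoeff p q = G.diffusionCoeff q p := by
  rcases p with ⟨i, α⟩
  rcases q with ⟨j, β⟩
  by_cases h : α = β
  · subst h
    simp [diffusionCoeff, G.w_symm α i j]
  · simp [diffusionCoeff, h, Ne.symm h, G.Dinter_symm α β, eq_comm]

theorem diffusionCoeff_nonneg (p q : Fin N × Fin M) : 0 ≤ G.diffusionCoeff p q := by
  unfold diffusionCoeff
  have h1 := mul_nonneg (G.D_nonneg p.2) (G.w_nonneg p.2 p.1 q.1)
  have h2 := G.Dinter_nonneg p.2 q.2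
  split_ifs <;> linarith

theorem diffusionCoeff_pos_of_adj {p q : Fin N × Fin M} (h : G.replicaGraph.Adj p q) :
    0 < G.diffusionCoeff p q := by
  rcases p with ⟨i, α⟩
  rcases q with ⟨j, β⟩
  obtain ⟨hne, ⟨h1, h2⟩ | ⟨h1, h2⟩⟩ := h
  · dsimp only at h1 h2
    subst h1
    simpa [diffusionCoeff] using h2
  · dsimp only at h1 h2
    subst h1
    have hαβ : α ≠ β := fun h => hne (by rw [h])
    simpa [diffusionCoeff, hαβ] using h2

theorem supraLap_apply (y : ReplicaSpace N M) (p : Fin N × Fin M) :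
    G.supraLap y p = ∑ q, G.diffusionCoeff p q * (y p - y q) := by
  rcases p with ⟨i, α⟩
  have h1 : ∑ q, G.intraPart (i, α) q * y q =
      ∑ j, G.D α * G.w α i j * (y (i, α) - y (j, α)) := by
    rw [Fintype.sum_prod_type]
    have : ∀ j, ∑ β, G.intraPart (i, α) (j, β) * y (j, β) =
        G.D α * G.layerLaplacian α i j * y (j, α) := fun j => by
      simp [intraPart, Matrix.blockDiagonal_apply]
    simp only [this, layerLaplacian, Matrix.sub_apply, Matrix.of_apply, Matrix.diagonal_apply,
      mul_sub, sub_mul, Finset.sum_sub_distrib, mul_ite, ite_mul, mul_zero, zero_mul,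
      Finset.sum_ite_eq, Finset.mem_univ, if_true, Finset.mul_sum, Finset.sum_mul]
  have h2 : ∑ q, G.interPart (i, α) q * y q =
      ∑ β, if α ≠ β then G.Dinter α β * (y (i, α) - y (i, β)) else 0 := by
    rw [Fintype.sum_prod_type, Finset.sum_eq_single i (fun j _ hj => by
      simp [interPart, hj.symm]) (by simp)]
    rw [← Finset.sum_filter, ← Finset.add_sum_erase _ _ (Finset.mem_univ α)]
    have he : Finset.univ.filter (fun β => α ≠ β) = Finset.univ.erase α := by
      ext β
      simp [eq_comm]
    rw [he]
    simp only [mul_sub, Finset.sum_sub_distrib, ← Finset.sum_mul]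
    have h3 : ∑ β ∈ Finset.univ.erase α, G.interPart (i, α) (i, β) * y (i, β) =
        ∑ β ∈ Finset.univ.erase α, -(G.Dinter α β * y (i, β)) :=
      Finset.sum_congr rfl fun β hβ => by
        simp [interPart, (Finset.ne_of_mem_erase hβ).symm]
    rw [h3, Finset.sum_neg_distrib]
    simp [interPart, sub_eq_add_neg]
  have h0 : G.supraLap y (i, α) =
      ∑ q, G.intraPart (i, α) q * y q + ∑ q, G.interPart (i, α) q * y q := by
    simp only [← Finset.sum_add_distrib, ← add_mul]
    rfl
  rw [h0, h1, h2]
  simp only [diffusionCoeff, add_mul, Finset.sum_add_distrib]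
  congr 1
  · rw [Fintype.sum_prod_type]
    simp
  · rw [Fintype.sum_prod_type, Finset.sum_comm]
    simp [ite_and]

/-- Exchanging `p` and `q` symmetrizes the sum, whence the factor `1 / 2`. Symmetry, positivity and
the kernel of the supra-Laplacian are all read off this form. -/
theorem inner_supraLap (u v : ReplicaSpace N M) :
    inner ℝ u (G.supraLap v) =
      (1 / 2) * ∑ p, ∑ q, G.diffusionCoeff p q * ((u p - u q) * (v p - v q)) := by
  have h1 : inner ℝ u (G.supraLap v) =
      ∑ p, ∑ q, G.diffusionCoeff p q * (u p * (v p - v q)) := by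
    simp only [PiLp.inner_apply, supraLap_apply, RCLike.inner_apply, conj_trivial,
      Finset.sum_mul]
    exact Finset.sum_congr rfl fun p _ => Finset.sum_congr rfl fun q _ => by ring
  have h2 : ∑ p, ∑ q, G.diffusionCoeff p q * (u p * (v p - v q)) =
      ∑ p, ∑ q, G.diffusionCoeff p q * (-(u q) * (v p - v q)) := by
    rw [Finset.sum_comm]
    refine Finset.sum_congr rfl fun p _ => Finset.sum_congr rfl fun q _ => ?_
    rw [G.diffusionCoeff_symm]
    ring
  have h3 : ∑ p, ∑ q, G.diffusionCoeff p q * ((u p - u q) * (v p - v q)) =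
      ∑ p, ∑ q, G.diffusionCoeff p q * (u p * (v p - v q)) +
        ∑ p, ∑ q, G.diffusionCoeff p q * (-(u q) * (v p - v q)) := by
    simp only [← Finset.sum_add_distrib]
    exact Finset.sum_congr rfl fun p _ => Finset.sum_congr rfl fun q _ => by ring
  rw [h3, ← h2, h1]
  ring

theorem inner_supraLap_left (u v : ReplicaSpace N M) :
    inner ℝ (G.supraLap u) v = inner ℝ u (G.supraLap v) := by
  rw [real_inner_comm, inner_supraLap, inner_supraLap]
  simp only [mul_comm]

theorem inner_supraLap_self_nonneg (v : ReplicaSpace N M) : 0 ≤ inner ℝ v (G.supraLap v) := by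
  rw [inner_supraLap]
  exact mul_nonneg (by norm_num) (Finset.sum_nonneg fun p _ => Finset.sum_nonneg fun q _ =>
    mul_nonneg (G.diffusionCoeff_nonneg p q) (mul_self_nonneg _))

theorem supraLap_onesVec : G.supraLap (onesVec N M) = 0 := by
  ext p
  simp [supraLap_apply, onesVec]

theorem exists_eq_smul_onesVec_of_supraLap_eq_zero (hG : G.Connected) {v : ReplicaSpace N M}
    (hv : G.supraLap v = 0) : ∃ x : ℝ, v = x • onesVec N M := by
  have h0 := G.inner_supraLap v v
  have hnn : ∀ p q, 0 ≤ G.diffusionCoeff p q * ((v p - v q) * (v p - v q)) := fun p q =>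
    mul_nonneg (G.diffusionCoeff_nonneg p q) (mul_self_nonneg _)
  rw [hv, inner_zero_right, zero_eq_mul, or_iff_right (by norm_num),
    Finset.sum_eq_zero_iff_of_nonneg fun p _ => Finset.sum_nonneg fun q _ => hnn p q] at h0
  have hadj : ∀ p q, G.replicaGraph.Adj p q → v p = v q := fun p q hpq => by
    have h1 := (Finset.sum_eq_zero_iff_of_nonneg fun q _ => hnn p q).1
      (h0 p (Finset.mem_univ p)) q (Finset.mem_univ q)
    have h2 := (mul_eq_zero.1 h1).resolve_left (G.diffusionCoeff_pos_of_adj hpq).ne'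
    exact sub_eq_zero.1 (mul_self_eq_zero.1 h2)
  have hwalk : ∀ p q, G.replicaGraph.Walk p q → v p = v q := fun p q w => by
    induction w with
    | nil => rfl
    | cons h _ ih => exact (hadj _ _ h).trans ih
  obtain ⟨p₀⟩ := hG.nonempty
  refine ⟨v p₀, ?_⟩
  ext p
  obtain ⟨w⟩ := hG.preconnected p p₀
  simp [onesVec, hwalk _ _ w]

/-- For a symmetric operator in finite dimension the range is the orthogonal complement of the
kernel, here the line of constant vectors. -/
theorem exists_supraLap_eq_of_inner_onesVec_eq_zero (hG : G.Connected) {g : ReplicaSpace N M}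
    (hg : inner ℝ (onesVec N M) g = 0) : ∃ v, G.supraLap v = g := by
  have hsymm : G.supraLap.IsSymmetric := G.inner_supraLap_left
  have h1 : g ∈ (LinearMap.range G.supraLap)ᗮᗮ := by
    rw [hsymm.orthogonal_range, Submodule.mem_orthogonal]
    intro u hu
    obtain ⟨x, rfl⟩ := G.exists_eq_smul_onesVec_of_supraLap_eq_zero hG hu
    rw [real_inner_smul_left, hg, mul_zero]
  rwa [Submodule.orthogonal_orthogonal] at h1

end MultiplexNetwork

/-! ### Optimality, conservation and saddle points -/

theorem inner_onesVec {N M : ℕ} (v : ReplicaSpace N M) :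
    inner ℝ v (onesVec N M) = ∑ p, v p := by
  simp [PiLp.inner_apply, onesVec]

theorem inner_onesVec_gradient_eq_zero_of_isMinOn {N M : ℕ} {f : ReplicaSpace N M → ℝ}
    (hf : Differentiable ℝ f) {x : ℝ} (hx : IsMinOn (primalObjective f) univ x) :
    inner ℝ (onesVec N M) (gradient f (x • onesVec N M)) = 0 := by
  have hd : HasDerivAt (primalObjective f) (inner ℝ (onesVec N M)
      (gradient f (x • onesVec N M))) x := by
    have h1 := (hf (x • onesVec N M)).hasFDerivAt.comp_hasDerivAt x
      ((hasDerivAt_id x).smul_const (onesVec N M))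
    rw [real_inner_comm, gradient, InnerProductSpace.toDual_symm_apply]
    rw [one_smul] at h1
    exact h1
  exact (hx.isLocalMin univ_mem).hasDerivAt_eq_zero hd

namespace MultiplexNetwork

variable {N M : ℕ} {G : MultiplexNetwork N M} {f : ReplicaSpace N M → ℝ}

/-- The saddle-point dynamics preserves the average of the multipliers. -/
theorem IsTrajectory.inner_onesVec_eq {y l : ℝ → ReplicaSpace N M} (h : G.IsTrajectory f y l)
    {t : ℝ} (ht : 0 ≤ t) : inner ℝ (l t) (onesVec N M) = inner ℝ (l 0) (onesVec N M) := by
  have hd : ∀ s, 0 ≤ s →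
      HasDerivWithinAt (fun s => inner ℝ (l s) (onesVec N M)) (0 : ℝ) (Ici 0) s := fun s hs => by
    have h1 := (h.dual s hs).inner ℝ (hasDerivWithinAt_const s (Ici 0) (onesVec N M))
    rwa [inner_zero_right, inner_supraLap_left, supraLap_onesVec, inner_zero_right,
      add_zero] at h1
  have h2 := (convex_Ici 0).norm_image_sub_le_of_norm_hasDerivWithin_le (C := 0)
    (fun s hs => hd s hs) (by simp) (self_mem_Ici (a := (0 : ℝ))) ht
  rw [zero_mul] at h2
  exact sub_eq_zero.1 (norm_le_zero_iff.1 h2)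

/-- As `a` is in the kernel, the Lagrangian at `a` does not depend on the multiplier; at `b`, the
term `⟪b, 𝓛 u⟫` cancels the linear term of the first-order bound for `f` at `a`. -/
theorem isSaddlePointOn_augLagrangian (hf : Differentiable ℝ f) (hconv : ConvexOn ℝ univ f)
    {a b : ReplicaSpace N M} (ha : G.supraLap a = 0) (hab : G.supraLap b + gradient f a = 0) :
    IsSaddlePointOn univ univ (G.augLagrangian f) a b := by
  intro u _ v _
  have h1 := hconv.add_inner_gradient_le (hf a) u
  have h2 := G.inner_supraLap_self_nonneg u
  rw [eq_neg_of_add_eq_zero_right hab, inner_neg_left, inner_supraLap_left, map_sub, ha,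
    sub_zero] at h1
  simp only [augLagrangian, ha, inner_zero_right, mul_zero, add_zero]
  linarith

theorem isMinOn_primalObjective (hf : Differentiable ℝ f) (hconv : ConvexOn ℝ univ f)
    {x : ℝ} {b : ReplicaSpace N M} (hb : G.supraLap b + gradient f (x • onesVec N M) = 0) :
    IsMinOn (primalObjective f) univ x := by
  intro z _
  have h1 := hconv.add_inner_gradient_le (hf (x • onesVec N M)) (z • onesVec N M)
  rw [eq_neg_of_add_eq_zero_right hb, inner_neg_left, inner_supraLap_left, ← sub_smul, map_smul,
    supraLap_onesVec, smul_zero, inner_zero_right, neg_zero, add_zero] at h1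
  exact h1

end MultiplexNetwork

theorem mainTheorem1 {N M : ℕ} (G : MultiplexNetwork N M) (hG : G.Connected)
    (f : ReplicaSpace N M → ℝ) (hf : ContDiff ℝ 2 f) (hconv : ConvexOn ℝ univ f)
    (hmin : ∃ x : ℝ, IsMinOn (primalObjective f) univ x)
    (y l : ℝ → ReplicaSpace N M) (htraj : G.IsTrajectory f y l) :
    ∃ ystar lstar : ReplicaSpace N M,
      Tendsto y atTop (𝓝 ystar) ∧ Tendsto l atTop (𝓝 lstar) ∧
      IsSaddlePointOn univ univ (G.augLagrangian f) ystar lstar ∧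
      (∃ xstar : ℝ, ystar = xstar • onesVec N M ∧ IsMinOn (primalObjective f) univ xstar) ∧
      (∃ lbar : ReplicaSpace N M,
        lstar = lbar + replicaAverage (l 0) • onesVec N M ∧
        inner ℝ lbar (onesVec N M) = 0 ∧
        G.supraLap lbar + gradient f ystar = 0) := by
  have hfd : Differentiable ℝ f := hf.differentiable (by norm_num)
  obtain ⟨x, hx⟩ := hmin
  obtain ⟨b₀, hb₀⟩ := G.exists_supraLap_eq_of_inner_onesVec_eq_zero hG
    (g := -gradient f (x • onesVec N M))
    (by rw [inner_neg_right, inner_onesVec_gradient_eq_zero_of_isMinOn hfd hx, neg_zero])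
  obtain ⟨a, b, ha, hab, hya, hlb⟩ := saddleFlow_tendsto
    (A := LinearMap.toContinuousLinearMap G.supraLap) (hf.of_le (by norm_num)) hconv
    G.inner_supraLap_left G.inner_supraLap_self_nonneg htraj.primal htraj.dual
    ⟨x • onesVec N M, b₀, by simp [G.supraLap_onesVec], by simp [hb₀]⟩
  rw [LinearMap.coe_toContinuousLinearMap'] at ha hab
  obtain ⟨xstar, rfl⟩ := G.exists_eq_smul_onesVec_of_supraLap_eq_zero hG ha
  refine ⟨_, b, hya, hlb, MultiplexNetwork.isSaddlePointOn_augLagrangian hfd hconv ha hab,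
    ⟨xstar, rfl, MultiplexNetwork.isMinOn_primalObjective hfd hconv hab⟩,
    b - replicaAverage (l 0) • onesVec N M, by abel, ?_, ?_⟩
  · have h1 : inner ℝ b (onesVec N M) = inner ℝ (l 0) (onesVec N M) := by
      refine tendsto_nhds_unique (hlb.inner tendsto_const_nhds) (tendsto_const_nhds.congr' ?_)
      filter_upwards [eventually_ge_atTop 0] with t ht
      exact (htraj.inner_onesVec_eq ht).symm
    -- A replica node exists, so the average does not divide by zero.
    obtain ⟨p⟩ := hG.nonempty
    have hN : (N : ℝ) ≠ 0 := Nat.cast_ne_zero.2 p.1.pos.ne'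
    have hM : (M : ℝ) ≠ 0 := Nat.cast_ne_zero.2 p.2.pos.ne'
    rw [inner_sub_left, h1, real_inner_smul_left, inner_onesVec, inner_onesVec, replicaAverage]
    simp [onesVec]
    field_simp
    simp
  · rw [map_sub, map_smul, G.supraLap_onesVec, smul_zero, sub_zero, hab]
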